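/- Let $S=K[x_1,\ldots,x_n]$ be a polynomial ring over a field $K$ with its standard grading, and let $M\subseteq S$ be a monomial ideal with minimal monomial generating set $G$. Suppose that $M$ is quadratic (every $m\in G$ has degree $2$) and dominant (for every $m\in G$ there is a variable $x$ such that the exponent of $x$ in $m$ is larger than the exponent of $x$ in every $m'\in G\setminus\{m\}$). Let $$U=\{m\in G:\ \gcd(m,m')=1\ \text{for all } m'\in G\setminus\{m\}\},$$ and let $k$ be the number of variables among $x_1,\ldots,x_n$ that divide more than one element of $G$. Then $$\operatorname{reg}(S/M)=\#U+k=\operatorname{codim}(S/M),$$ where $\operatorname{reg}(S/M)=\max\{s:\ \beta_{i,i+s}(S/M)\neq 0\text{ for some } i\}$, the $\beta_{i,j}(S/M)$ are the graded Betti numbers given by a minimal graded free resolution of $S/M$ over $S$, and $\operatorname{codim}(S/M)$ is the height of $\operatorname{ann}_S(S/M)=M$. -/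

import Mathlib

open MvPolynomial

/-! ### Monomial ideals

A monomial of `K[x₁, …, xₙ]` is given by its exponent vector `m : Fin n →₀ ℕ`; divisibility is `≤`,
the gcd is `⊓`, the monomial `1` is the vector `0`, and `x ∣ m` means `m x ≠ 0`. -/

/-- The ideal of `K[x₁, …, xₙ]` generated by a finite set of monomials. -/
noncomputable def monomialIdeal (K : Type*) [Field K] {n : ℕ} (G : Finset (Fin n →₀ ℕ)) :
    Ideal (MvPolynomial (Fin n) K) :=
  Ideal.span ((fun m => monomial m (1 : K)) '' (G : Set (Fin n →₀ ℕ)))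

/-- `M` is minimally generated by the finite set `G` of monomials. -/
def IsMinimallyGeneratedBy {K : Type*} [Field K] {n : ℕ} (M : Ideal (MvPolynomial (Fin n) K))
    (G : Finset (Fin n →₀ ℕ)) : Prop :=
  monomialIdeal K G = M ∧ ∀ G' : Finset (Fin n →₀ ℕ), G' ⊂ G → monomialIdeal K G' ≠ M

/-- `m` is dominant in `G`: for some variable `x`, the exponent of `x` in `m` is larger than its
exponent in every other element of `G`. -/
def IsDominantIn {n : ℕ} (G : Finset (Fin n →₀ ℕ)) (m : Fin n →₀ ℕ) : Prop :=
  ∃ x : Fin n, ∀ m' ∈ G, m' ≠ m → m' x < m x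

/-- The elements of `G` that are coprime to all other elements of `G`. -/
noncomputable def coprimeGenerators {n : ℕ} (G : Finset (Fin n →₀ ℕ)) : Finset (Fin n →₀ ℕ) :=
  open Classical in G.filter (fun m => ∀ m' ∈ G, m' ≠ m → m ⊓ m' = 0)

/-- The variables that divide more than one element of `G`. -/
def sharedVariables {n : ℕ} (G : Finset (Fin n →₀ ℕ)) : Finset (Fin n) :=
  Finset.univ.filter (fun x => 1 < (G.filter (fun m => m x ≠ 0)).card)

/-! ### Codimension -/

/-- The codimension of a module: the height of its annihilator. -/
noncomputable def moduleCodim (R : Type*) [CommRing R] (N : Type*) [AddCommGroup N] [Module R N] :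
    ℕ∞ :=
  (Module.annihilator R N).height

/-! ### Graded modules, minimal graded free resolutions, regularity -/

/-- The component of degree `j` of `K[x₁, …, xₙ]` in the standard `ℤ`-grading. -/
noncomputable def polyPart (K : Type*) [Field K] (n : ℕ) (j : ℤ) :
    Submodule K (MvPolynomial (Fin n) K) :=
  if 0 ≤ j then homogeneousSubmodule (Fin n) K j.toNat else ⊥

/-- The component of degree `j` of `S ⧸ M`: the image of the component of degree `j` of `S`. -/
noncomputable def quotientPart {K : Type*} [Field K] {n : ℕ} (M : Ideal (MvPolynomial (Fin n) K))
    (j : ℤ) : Submodule K (MvPolynomial (Fin n) K ⧸ M) :=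
  (polyPart K n j).map (Ideal.Quotient.mkₐ K M).toLinearMap

/-- `v` lies in the component of degree `j` of the graded free module `⨁ₐ S(-d a)`, whose basis
element `eₐ` has degree `d a`. -/
def IsFreeHomogeneous {K : Type*} [Field K] {n r : ℕ} (d : Fin r → ℤ)
    (j : ℤ) (v : Fin r → MvPolynomial (Fin n) K) : Prop :=
  ∀ a, v a ∈ polyPart K n (j - d a)

/-- A minimal graded free resolution `⋯ → F₂ → F₁ → F₀ → N → 0` of a graded module `N` over
`S = K[x₁, …, xₙ]` (with graded components `𝒩 j`): the module `Fᵢ` is free of finite rank with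
basis elements of prescribed degrees, all maps are homogeneous of degree `0`, the sequence is
exact, and the image of `Fᵢ₊₁` is contained in `(x₁, …, xₙ) Fᵢ`. -/
structure MinimalGradedFreeResolution (K : Type*) [Field K] (n : ℕ) {N : Type*} [AddCommGroup N]
    [Module (MvPolynomial (Fin n) K) N] [Module K N] (𝒩 : ℤ → Submodule K N) where
  /-- the rank of `Fᵢ` -/
  rank : ℕ → ℕ
  /-- the degrees of the basis elements of `Fᵢ` -/
  deg : (i : ℕ) → Fin (rank i) → ℤ
  /-- the differential `Fᵢ₊₁ → Fᵢ` -/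
  d : (i : ℕ) → (Fin (rank (i + 1)) → MvPolynomial (Fin n) K) →ₗ[MvPolynomial (Fin n) K]
    (Fin (rank i) → MvPolynomial (Fin n) K)
  /-- the augmentation `F₀ → N` -/
  aug : (Fin (rank 0) → MvPolynomial (Fin n) K) →ₗ[MvPolynomial (Fin n) K] N
  d_homogeneous : ∀ i b, IsFreeHomogeneous (deg i) (deg (i + 1) b) (d i (Pi.single b 1))
  aug_homogeneous : ∀ a, aug (Pi.single a 1) ∈ 𝒩 (deg 0 a)
  aug_surjective : Function.Surjective aug
  exact_zero : Function.Exact (d 0) aug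
  exact_succ : ∀ i, Function.Exact (d (i + 1)) (d i)
  minimal : ∀ i v a, d i v a ∈ Ideal.span (Set.range (X : Fin n → MvPolynomial (Fin n) K))

/-- The graded Betti number `β_{i,j}` read off from a minimal graded free resolution: the number of
basis elements of degree `j` in homological degree `i`. -/
def MinimalGradedFreeResolution.betti {K : Type*} [Field K] {n : ℕ} {N : Type*} [AddCommGroup N]
    [Module (MvPolynomial (Fin n) K) N] [Module K N] {𝒩 : ℤ → Submodule K N}
    (F : MinimalGradedFreeResolution K n 𝒩) (i : ℕ) (j : ℤ) : ℕ :=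
  (Finset.univ.filter (fun a => F.deg i a = j)).card

/-- `reg N = r`: the graded module `N` has a minimal graded free resolution, and `r` is the maximum
of all `s` such that `β_{i,i+s}(N) ≠ 0` for some `i`, the Betti numbers being computed from any
minimal graded free resolution. -/
def HasRegularity (K : Type*) [Field K] (n : ℕ) {N : Type*} [AddCommGroup N]
    [Module (MvPolynomial (Fin n) K) N] [Module K N] (𝒩 : ℤ → Submodule K N) (r : ℤ) : Prop :=
  Nonempty (MinimalGradedFreeResolution K n 𝒩) ∧
    ∀ F : MinimalGradedFreeResolution K n 𝒩,
      IsGreatest {s : ℤ | ∃ i : ℕ, F.betti i (i + s) ≠ 0} r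

/-! Dominance gives each generator `m` a variable `y m` whose exponent in `m` exceeds its exponent
in every other generator; write `m = y m * z m`. Then no generator divides the lcm of others, so
deleting a generator from any subset changes the lcm (`sup_erase_ne`) and the Taylor resolution is
minimal. Hence `β_{i,j} ≠ 0` exactly when some `i` generators have an lcm of degree `j`
(`Taylor.betti_ne_zero_iff`), whichever minimal resolution is used (`betti_ne_zero_congr`).

So the regularity is the maximum of `deg lcm σ - #σ`. Adding a generator raises the degree by at
least one (`degree_sup_add_card_le`), so `σ = G` attains it. The `y m` are distinct, and if `y m`
divides another generator, then `m` is its square, so `z m = y m`. This gives `lcm G = ∏ y m · ∏ x`,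
with `x` over the distinct values of `z` (`sup_eq`), and the regularity is the number of these
values.

The codimension is the same number: `M` lies in the ideal of the variables `z m`, while a prime
containing `M` contains `y m` or `z m` for each `m`, which yields distinct variables for distinct
values of `z` (`card_le_height_of_isPrime`). Finally the values of `z` are the shared variables
together with one variable for each element of `U` (`card_image_eq`). -/

/-! ### Lifting maps and building chain maps out of free modules. -/

section ChainMaps

variable {S : Type*} [CommRing S]

/-- A linear map from a finite free module lifts along `d` as soon as the images of the basis
vectors do, with prescribed choices of the lifts. -/
theorem exists_linearMap_lift {r : ℕ} {A B : Type*} [AddCommGroup A] [Module S A]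
    [AddCommGroup B] [Module S B] (d : A →ₗ[S] B) (f : (Fin r → S) →ₗ[S] B)
    (P : Fin r → A → Prop) (h : ∀ a, ∃ w, P a w ∧ d w = f (Pi.single a 1)) :
    ∃ g : (Fin r → S) →ₗ[S] A, d ∘ₗ g = f ∧ ∀ a, P a (g (Pi.single a 1)) := by
  choose w hP hw using h
  refine ⟨(Pi.basisFun S (Fin r)).constr ℕ w, (Pi.basisFun S (Fin r)).ext fun a => ?_,
    fun a => ?_⟩
  · rw [LinearMap.comp_apply, Module.Basis.constr_basis, hw, Pi.basisFun_apply]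
  · rw [← Pi.basisFun_apply, Module.Basis.constr_basis]
    exact hP a

/-- Construction of a chain map degree by degree, preserving a property of its components. -/
theorem exists_chainMap {A B : ℕ → Type*} [∀ i, AddCommGroup (A i)] [∀ i, Module S (A i)]
    [∀ i, AddCommGroup (B i)] [∀ i, Module S (B i)]
    (dA : ∀ i, A (i + 1) →ₗ[S] A i) (dB : ∀ i, B (i + 1) →ₗ[S] B i)
    (hA : ∀ i v, dA i (dA (i + 1) v) = 0)
    (hB : ∀ i v, dB i v = 0 → v ∈ LinearMap.range (dB (i + 1)))
    (P : ∀ i, (A i →ₗ[S] B i) → Prop)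
    (f₀ : A 0 →ₗ[S] B 0) (h₀ : P 0 f₀)
    (hr₀ : ∀ v, f₀ (dA 0 v) ∈ LinearMap.range (dB 0))
    (step : ∀ i (f : A i →ₗ[S] B i), P i f → (∀ v, f (dA i v) ∈ LinearMap.range (dB i)) →
      ∃ g : A (i + 1) →ₗ[S] B (i + 1), dB i ∘ₗ g = f ∘ₗ dA i ∧ P (i + 1) g) :
    ∃ f : ∀ i, A i →ₗ[S] B i, f 0 = f₀ ∧ (∀ i, P i (f i)) ∧
      ∀ i v, dB i (f (i + 1) v) = f i (dA i v) := by
  let Good := fun i => {f : A i →ₗ[S] B i // P i f ∧ ∀ v, f (dA i v) ∈ LinearMap.range (dB i)}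
  have next : ∀ i (f : Good i), ∃ g : Good (i + 1), ∀ v, dB i (g.1 v) = f.1 (dA i v) := by
    rintro i ⟨f, hP, hr⟩
    obtain ⟨g, hg, hPg⟩ := step i f hP hr
    have hg' : ∀ v, dB i (g v) = f (dA i v) := fun v => LinearMap.congr_fun hg v
    refine ⟨⟨g, hPg, fun v => hB i _ ?_⟩, hg'⟩
    rw [hg', hA, map_zero]
  choose nx hnx using next
  let F : ∀ i, Good i := fun i => Nat.rec ⟨f₀, h₀, hr₀⟩ nx i
  exact ⟨fun i => (F i).1, rfl, fun i => (F i).2.1, fun i => hnx i (F i)⟩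

end ChainMaps

/-! ### Homogeneous components of polynomials and of graded free modules. -/

section GradedPolynomials

variable {K : Type*} [Field K] {n : ℕ}

theorem weight_one_eq_degree (u : Fin n →₀ ℕ) :
    Finsupp.weight (1 : Fin n → ℕ) u = u.degree :=
  (DFunLike.congr_fun (Finsupp.degree_eq_weight_one (R := ℕ)) u).symm

theorem mem_polyPart_iff {j : ℤ} {p : MvPolynomial (Fin n) K} :
    p ∈ polyPart K n j ↔ ∀ u, coeff u p ≠ 0 → (u.degree : ℤ) = j := by
  unfold polyPart
  split_ifs with h
  · rw [mem_homogeneousSubmodule]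
    constructor
    · intro hp u hu
      have := hp hu
      rw [weight_one_eq_degree] at this
      omega
    · intro hp u hu
      have := hp u hu
      rw [weight_one_eq_degree]
      omega
  · rw [Submodule.mem_bot]
    constructor
    · rintro rfl u hu
      simp at hu
    · intro hp
      ext u
      by_contra hu
      have := hp u (by simpa using hu)
      omega

/-- The component of degree `j : ℤ` of a polynomial. -/
noncomputable def polyComponent (K : Type*) [Field K] (n : ℕ) (j : ℤ) :
    MvPolynomial (Fin n) K →ₗ[K] MvPolynomial (Fin n) K :=
  if 0 ≤ j then homogeneousComponent j.toNat else 0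

theorem coeff_polyComponent (j : ℤ) (p : MvPolynomial (Fin n) K) (u : Fin n →₀ ℕ) :
    coeff u (polyComponent K n j p) = if (u.degree : ℤ) = j then coeff u p else 0 := by
  unfold polyComponent
  split_ifs with h h' h'
  · rw [coeff_homogeneousComponent, if_pos (by omega)]
  · rw [coeff_homogeneousComponent, if_neg (by omega)]
  · omega
  · simp

theorem polyComponent_mem (j : ℤ) (p : MvPolynomial (Fin n) K) :
    polyComponent K n j p ∈ polyPart K n j := by
  rw [mem_polyPart_iff]
  intro u hu
  rw [coeff_polyComponent] at hu
  by_contra h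
  exact hu (if_neg h)

theorem polyComponent_of_mem {j : ℤ} {p : MvPolynomial (Fin n) K} (hp : p ∈ polyPart K n j) :
    polyComponent K n j p = p := by
  ext u
  rw [coeff_polyComponent]
  split_ifs with h
  · rfl
  · by_contra hu
    exact h (mem_polyPart_iff.1 hp u (Ne.symm hu))

theorem polyComponent_mul {e : ℤ} (j : ℤ) (p : MvPolynomial (Fin n) K)
    {q : MvPolynomial (Fin n) K} (hq : q ∈ polyPart K n e) :
    polyComponent K n (j + e) (p * q) = polyComponent K n j p * q := by
  classical
  ext u
  rw [coeff_polyComponent, coeff_mul, coeff_mul]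
  split_ifs with h
  · refine Finset.sum_congr rfl fun x hx => ?_
    rw [coeff_polyComponent]
    by_cases hx0 : coeff x.2 q = 0
    · simp [hx0]
    · have h2 := mem_polyPart_iff.1 hq _ hx0
      rw [← Finset.HasAntidiagonal.mem_antidiagonal.1 hx, map_add] at h
      push_cast at h
      rw [if_pos (by omega)]
  · refine (Finset.sum_eq_zero fun x hx => ?_).symm
    rw [coeff_polyComponent]
    by_cases hx0 : coeff x.2 q = 0
    · simp [hx0]
    · have h2 := mem_polyPart_iff.1 hq _ hx0
      rw [← Finset.HasAntidiagonal.mem_antidiagonal.1 hx, map_add] at h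
      push_cast at h
      rw [if_neg (by omega), zero_mul]

theorem monomial_mem_polyPart (u : Fin n →₀ ℕ) (c : K) :
    monomial u c ∈ polyPart K n u.degree := by
  classical
  rw [mem_polyPart_iff]
  intro v hv
  rw [coeff_monomial] at hv
  split_ifs at hv with h
  · rw [h]
  · exact absurd rfl hv

theorem constantCoeff_eq_zero_of_mem_span_X {p : MvPolynomial (Fin n) K}
    (hp : p ∈ Ideal.span (Set.range (X : Fin n → MvPolynomial (Fin n) K))) :
    constantCoeff p = 0 := by
  have : Ideal.span (Set.range (X : Fin n → MvPolynomial (Fin n) K)) ≤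
      RingHom.ker (constantCoeff (R := K) (σ := Fin n)) := by
    rw [Ideal.span_le]
    rintro _ ⟨i, rfl⟩
    exact constantCoeff_X _ i
  exact this hp

theorem LinearMap.apply_eq_sum_mul {S : Type*} [CommRing S] {r s : ℕ}
    (f : (Fin r → S) →ₗ[S] (Fin s → S)) (v : Fin r → S) (b : Fin s) :
    f v b = ∑ a, v a * f (Pi.single a 1) b := by
  conv_lhs => rw [← (Pi.basisFun S (Fin r)).sum_repr v]
  simp [map_sum, Finset.sum_apply]

/-- A map of graded free modules that sends basis elements to homogeneous elements of the same
degree. -/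
def IsGradedMap {r s : ℕ} (d : Fin r → ℤ) (e : Fin s → ℤ)
    (f : (Fin r → MvPolynomial (Fin n) K) →ₗ[MvPolynomial (Fin n) K]
      (Fin s → MvPolynomial (Fin n) K)) : Prop :=
  ∀ a, IsFreeHomogeneous e (d a) (f (Pi.single a 1))

/-- The homogeneous component of degree `j` of an element of a graded free module. -/
noncomputable def freeComponent {r : ℕ} (d : Fin r → ℤ) (j : ℤ)
    (v : Fin r → MvPolynomial (Fin n) K) : Fin r → MvPolynomial (Fin n) K :=
  fun a => polyComponent K n (j - d a) (v a)

theorem freeComponent_isFreeHomogeneous {r : ℕ} (d : Fin r → ℤ) (j : ℤ)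
    (v : Fin r → MvPolynomial (Fin n) K) : IsFreeHomogeneous d j (freeComponent d j v) :=
  fun _ => polyComponent_mem _ _

theorem freeComponent_of_isFreeHomogeneous {r : ℕ} {d : Fin r → ℤ} {j : ℤ}
    {v : Fin r → MvPolynomial (Fin n) K} (hv : IsFreeHomogeneous d j v) :
    freeComponent d j v = v :=
  funext fun a => polyComponent_of_mem (hv a)

/-- The matrix entries of a graded map are homogeneous. This allows an arbitrary preimage of a
homogeneous element to be replaced by a homogeneous one. -/
theorem IsGradedMap.map_freeComponent {r s : ℕ} {d : Fin r → ℤ} {e : Fin s → ℤ}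
    {f : (Fin r → MvPolynomial (Fin n) K) →ₗ[MvPolynomial (Fin n) K]
      (Fin s → MvPolynomial (Fin n) K)} (hf : IsGradedMap d e f) (j : ℤ)
    (v : Fin r → MvPolynomial (Fin n) K) :
    f (freeComponent d j v) = freeComponent e j (f v) := by
  ext1 b
  rw [freeComponent, LinearMap.apply_eq_sum_mul f v b, map_sum, LinearMap.apply_eq_sum_mul]
  refine Finset.sum_congr rfl fun a _ => ?_
  rw [freeComponent, ← polyComponent_mul _ _ (hf a b)]
  congr 2
  ring

theorem IsGradedMap.map_isFreeHomogeneous {r s : ℕ} {d : Fin r → ℤ} {e : Fin s → ℤ}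
    {f : (Fin r → MvPolynomial (Fin n) K) →ₗ[MvPolynomial (Fin n) K]
      (Fin s → MvPolynomial (Fin n) K)} (hf : IsGradedMap d e f) {j : ℤ}
    {v : Fin r → MvPolynomial (Fin n) K} (hv : IsFreeHomogeneous d j v) :
    IsFreeHomogeneous e j (f v) := by
  rw [← freeComponent_of_isFreeHomogeneous hv, hf.map_freeComponent]
  exact freeComponent_isFreeHomogeneous _ _ _

end GradedPolynomials

/-! ### Comparison of minimal resolutions and independence of the nonvanishing of Betti numbers. -/

namespace MinimalGradedFreeResolution

variable {K : Type*} [Field K] {n : ℕ} {N : Type*} [AddCommGroup N]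
  [Module (MvPolynomial (Fin n) K) N] [Module K N] {𝒩 : ℤ → Submodule K N}

theorem d_d (F : MinimalGradedFreeResolution K n 𝒩) (i : ℕ)
    (v : Fin (F.rank (i + 1 + 1)) → MvPolynomial (Fin n) K) : F.d i (F.d (i + 1) v) = 0 :=
  (F.exact_succ i _).2 ⟨v, rfl⟩

theorem aug_d (F : MinimalGradedFreeResolution K n 𝒩)
    (v : Fin (F.rank (0 + 1)) → MvPolynomial (Fin n) K) : F.aug (F.d 0 v) = 0 :=
  (F.exact_zero _).2 ⟨v, rfl⟩

/-- The identity lifts to a chain map, each component of which respects the gradings if the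
augmentation of the target is surjective on homogeneous elements. -/
theorem exists_lift_id (F T : MinimalGradedFreeResolution K n 𝒩) (q : Prop)
    (hT : q → ∀ j, ∀ x ∈ 𝒩 j, ∃ w, IsFreeHomogeneous (T.deg 0) j w ∧ T.aug w = x) :
    ∃ f : ∀ i, (Fin (F.rank i) → MvPolynomial (Fin n) K) →ₗ[MvPolynomial (Fin n) K]
        (Fin (T.rank i) → MvPolynomial (Fin n) K),
      (∀ v, T.aug (f 0 v) = F.aug v) ∧ (∀ i v, T.d i (f (i + 1) v) = f i (F.d i v)) ∧
      (q → ∀ i, IsGradedMap (F.deg i) (T.deg i) (f i)) := by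
  -- The flag `q` makes homogeneity conditional, so that the same construction yields graded lifts
  -- and plain ones.
  obtain ⟨f₀, hf₀, hP₀⟩ := exists_linearMap_lift T.aug F.aug
    (fun a w => q → IsFreeHomogeneous (T.deg 0) (F.deg 0 a) w) (by
      intro a
      by_cases hq : q
      · obtain ⟨w, h1, h2⟩ := hT hq _ _ (F.aug_homogeneous a)
        exact ⟨w, fun _ => h1, h2⟩
      · obtain ⟨w, hw⟩ := T.aug_surjective (F.aug (Pi.single a 1))
        exact ⟨w, fun h => absurd h hq, hw⟩)
  have hf₀' : ∀ v, T.aug (f₀ v) = F.aug v := fun v => LinearMap.congr_fun hf₀ v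
  obtain ⟨f, rfl, hP, hc⟩ := exists_chainMap
    (A := fun i => Fin (F.rank i) → MvPolynomial (Fin n) K)
    (B := fun i => Fin (T.rank i) → MvPolynomial (Fin n) K) F.d T.d F.d_d
    (fun i v hv => (T.exact_succ i v).1 hv)
    (fun i f => q → IsGradedMap (F.deg i) (T.deg i) f) f₀ (fun hq a => hP₀ a hq)
    (fun v => (T.exact_zero _).1 (by rw [hf₀', F.aug_d])) (by
      intro i f hf hr
      obtain ⟨g, h1, h2⟩ := exists_linearMap_lift (T.d i) (f ∘ₗ F.d i)
        (fun a w => q → IsFreeHomogeneous (T.deg (i + 1)) (F.deg (i + 1) a) w) (by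
          intro a
          obtain ⟨w, hw⟩ := hr (Pi.single a 1)
          by_cases hq : q
          · refine ⟨freeComponent (T.deg (i + 1)) (F.deg (i + 1) a) w,
              fun _ => freeComponent_isFreeHomogeneous _ _ _, ?_⟩
            rw [IsGradedMap.map_freeComponent (T.d_homogeneous i), hw]
            exact freeComponent_of_isFreeHomogeneous
              ((hf hq).map_isFreeHomogeneous (F.d_homogeneous i a))
          · exact ⟨w, fun h => absurd h hq, hw⟩)
      exact ⟨g, h1, fun hq a => h2 a hq⟩)
  exact ⟨f, hf₀', hc, fun hq i => hP i hq⟩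

theorem map_apply_mem_of_forall_mem {S : Type*} [CommRing S] {r s : ℕ} (I : Ideal S)
    (f : (Fin r → S) →ₗ[S] (Fin s → S)) {v : Fin r → S} (hv : ∀ a, v a ∈ I) (b : Fin s) :
    f v b ∈ I := by
  rw [LinearMap.apply_eq_sum_mul]
  exact Ideal.sum_mem _ fun a _ => I.mul_mem_right _ (hv a)

/-- A chain endomorphism lifting `0` vanishes modulo the variables. -/
theorem endomorphism_mem_span_X (F : MinimalGradedFreeResolution K n 𝒩)
    (t : ∀ i, (Fin (F.rank i) → MvPolynomial (Fin n) K) →ₗ[MvPolynomial (Fin n) K]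
      (Fin (F.rank i) → MvPolynomial (Fin n) K))
    (h₀ : ∀ v, F.aug (t 0 v) = 0) (hc : ∀ i v, F.d i (t (i + 1) v) = t i (F.d i v))
    (i : ℕ) (v : Fin (F.rank i) → MvPolynomial (Fin n) K) (a : Fin (F.rank i)) :
    t i v a ∈ Ideal.span (Set.range (X : Fin n → MvPolynomial (Fin n) K)) := by
  -- A null-homotopy `t = d g + h d` is built degree by degree; by minimality both terms have
  -- entries in the ideal of the variables. The induction only needs to remember that `d h` and `t`
  -- agree on boundaries.
  suffices H : ∀ i, ∃ h : (Fin (F.rank i) → MvPolynomial (Fin n) K) →ₗ[MvPolynomial (Fin n) K]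
      (Fin (F.rank (i + 1)) → MvPolynomial (Fin n) K),
      (∀ v, F.d i (h (F.d i v)) = t i (F.d i v)) ∧
      ∀ v a, t i v a ∈ Ideal.span (Set.range (X : Fin n → MvPolynomial (Fin n) K)) by
    obtain ⟨h, -, h2⟩ := H i
    exact h2 v a
  intro i
  induction i with
  | zero =>
    obtain ⟨h, hh, -⟩ := exists_linearMap_lift (F.d 0) (t 0) (fun _ _ => True) (fun a => by
      obtain ⟨w, hw⟩ := (F.exact_zero _).1 (h₀ (Pi.single a 1))
      exact ⟨w, trivial, hw⟩)
    have hh' : ∀ v, F.d 0 (h v) = t 0 v := fun v => LinearMap.congr_fun hh v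
    exact ⟨h, fun v => hh' _, fun v a => hh' v ▸ F.minimal 0 _ a⟩
  | succ i ih =>
    obtain ⟨h, h1, -⟩ := ih
    obtain ⟨g, hg, -⟩ := exists_linearMap_lift (F.d (i + 1)) (t (i + 1) - h ∘ₗ F.d i)
      (fun _ _ => True) (fun a => by
        obtain ⟨w, hw⟩ := (F.exact_succ i ((t (i + 1) - h ∘ₗ F.d i) (Pi.single a 1))).1 (by
          simp only [LinearMap.sub_apply, LinearMap.comp_apply, map_sub, hc, h1, sub_self])
        exact ⟨w, trivial, hw⟩)
    have hg' : ∀ v, F.d (i + 1) (g v) = t (i + 1) v - h (F.d i v) :=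
      fun v => LinearMap.congr_fun hg v
    refine ⟨g, fun v => by rw [hg', F.d_d, map_zero, sub_zero], fun v a => ?_⟩
    have : t (i + 1) v a = F.d (i + 1) (g v) a + h (F.d i v) a := by
      rw [hg', Pi.sub_apply, sub_add_cancel]
    rw [this]
    exact Ideal.add_mem _ (F.minimal _ _ _)
      (map_apply_mem_of_forall_mem _ h (F.minimal i v) a)

/-- A composite of chain maps lifting the identity is the identity modulo the variables. -/
theorem exists_constantCoeff_ne_zero (F T : MinimalGradedFreeResolution K n 𝒩)
    (f : ∀ i, (Fin (F.rank i) → MvPolynomial (Fin n) K) →ₗ[MvPolynomial (Fin n) K]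
        (Fin (T.rank i) → MvPolynomial (Fin n) K))
    (g : ∀ i, (Fin (T.rank i) → MvPolynomial (Fin n) K) →ₗ[MvPolynomial (Fin n) K]
        (Fin (F.rank i) → MvPolynomial (Fin n) K))
    (hf₀ : ∀ v, T.aug (f 0 v) = F.aug v) (hf : ∀ i v, T.d i (f (i + 1) v) = f i (F.d i v))
    (hg₀ : ∀ v, F.aug (g 0 v) = T.aug v) (hg : ∀ i v, F.d i (g (i + 1) v) = g i (T.d i v))
    (i : ℕ) (a : Fin (F.rank i)) :
    ∃ b, constantCoeff (f i (Pi.single a 1) b) ≠ 0 ∧ constantCoeff (g i (Pi.single b 1) a) ≠ 0 := by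
  have h := constantCoeff_eq_zero_of_mem_span_X (F.endomorphism_mem_span_X
    (fun i => g i ∘ₗ f i - LinearMap.id)
    (fun v => by
      rw [LinearMap.sub_apply, map_sub, LinearMap.comp_apply, hg₀, hf₀, LinearMap.id_apply,
        sub_self])
    (fun i v => by
      simp only [LinearMap.sub_apply, map_sub, LinearMap.comp_apply, hg, hf, LinearMap.id_apply])
    i (Pi.single a 1) a)
  -- The diagonal entry of `g f - 1` at `a` has constant term zero, so the constant terms of the
  -- products of entries of `f` and `g` sum to 1, and some product is nonzero.
  rw [LinearMap.sub_apply, Pi.sub_apply, LinearMap.id_apply, Pi.single_eq_same,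
    LinearMap.comp_apply, LinearMap.apply_eq_sum_mul, map_sub, map_sum, map_one, sub_eq_zero] at h
  obtain ⟨b, -, hb⟩ := Finset.exists_ne_zero_of_sum_ne_zero (h ▸ one_ne_zero)
  rw [map_mul] at hb
  exact ⟨b, left_ne_zero_of_mul hb, right_ne_zero_of_mul hb⟩

theorem betti_ne_zero_iff (F : MinimalGradedFreeResolution K n 𝒩) (i : ℕ) (j : ℤ) :
    F.betti i j ≠ 0 ↔ ∃ a, F.deg i a = j := by
  rw [betti, Finset.card_ne_zero, Finset.filter_nonempty_iff]
  simp

/-- The entry is homogeneous of degree `d a - e b`, and a nonzero constant term forces this to be 0.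
-/
theorem IsGradedMap.deg_eq {r s : ℕ} {d : Fin r → ℤ} {e : Fin s → ℤ}
    {f : (Fin r → MvPolynomial (Fin n) K) →ₗ[MvPolynomial (Fin n) K]
      (Fin s → MvPolynomial (Fin n) K)} (hf : IsGradedMap d e f) {a : Fin r} {b : Fin s}
    (h : constantCoeff (f (Pi.single a 1) b) ≠ 0) : d a = e b := by
  have := mem_polyPart_iff.1 (hf a b) 0 h
  rw [map_zero] at this
  push_cast at this
  omega

/-- The vanishing of graded Betti numbers does not depend on the resolution. -/
theorem betti_ne_zero_congr (F T : MinimalGradedFreeResolution K n 𝒩)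
    (hT : ∀ j, ∀ x ∈ 𝒩 j, ∃ w, IsFreeHomogeneous (T.deg 0) j w ∧ T.aug w = x) (i : ℕ) (j : ℤ) :
    F.betti i j ≠ 0 ↔ T.betti i j ≠ 0 := by
  obtain ⟨f, hf₀, hf, hgr⟩ := F.exists_lift_id T True fun _ => hT
  -- A plain lift suffices here: both directions below find a nonzero constant entry of `f`, so only
  -- `f` has to be graded.
  obtain ⟨g, hg₀, hg, -⟩ := T.exists_lift_id F False False.elim
  rw [betti_ne_zero_iff, betti_ne_zero_iff]
  constructor
  · rintro ⟨a, rfl⟩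
    obtain ⟨b, hb, -⟩ := exists_constantCoeff_ne_zero F T f g hf₀ hf hg₀ hg i a
    exact ⟨b, (IsGradedMap.deg_eq (hgr trivial i) hb).symm⟩
  · rintro ⟨b, rfl⟩
    obtain ⟨a, -, ha⟩ := exists_constantCoeff_ne_zero T F g f hg₀ hg hf₀ hf i b
    exact ⟨a, IsGradedMap.deg_eq (hgr trivial i) ha⟩

end MinimalGradedFreeResolution

/-! ### The Taylor resolution: signs, differential, contracting homotopy, exactness. -/

namespace Taylor

section Sign

variable {ι : Type*} [LinearOrder ι]

/-- The sign with which `σ \ {g}` occurs in the boundary of the simplex `σ`. -/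
def sign (g : ι) (σ : Finset ι) : ℤ := (-1) ^ (σ.filter (· < g)).card

theorem sign_erase_of_lt {g g' : ι} {σ : Finset ι} (hg : g ∈ σ) (h : g < g') :
    sign g' σ = -sign g' (σ.erase g) := by
  unfold sign
  rw [← Finset.insert_erase hg, Finset.filter_insert, if_pos h, Finset.card_insert_of_notMem,
    pow_succ, Finset.erase_insert (Finset.notMem_erase _ _), mul_neg_one]
  simp

theorem sign_erase_of_not_lt {g g' : ι} (σ : Finset ι) (h : ¬ g < g') :
    sign g' (σ.erase g) = sign g' σ := by
  unfold sign
  congr 2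
  ext i
  simp only [Finset.mem_filter, Finset.mem_erase]
  constructor
  · rintro ⟨⟨_, h1⟩, h2⟩
    exact ⟨h1, h2⟩
  · rintro ⟨h1, h2⟩
    refine ⟨⟨?_, h1⟩, h2⟩
    rintro rfl
    exact h h2

theorem sign_of_le {g : ι} {σ : Finset ι} (h : ∀ i ∈ σ, g ≤ i) : sign g σ = 1 := by
  unfold sign
  rw [Finset.filter_eq_empty_iff.2 fun i hi => not_lt.2 (h i hi), Finset.card_empty, pow_zero]

/-- Deleting the smaller index flips the sign of the larger one, but not conversely; this is what
makes the differential square to zero. -/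
theorem sign_mul_sign_add {g g' : ι} {σ : Finset ι} (hg : g ∈ σ) (hg' : g' ∈ σ) (h : g ≠ g') :
    sign g σ * sign g' (σ.erase g) + sign g' σ * sign g (σ.erase g') = 0 := by
  rcases lt_or_gt_of_ne h with h | h
  · rw [sign_erase_of_lt hg h, sign_erase_of_not_lt σ (not_lt.2 h.le)]
    ring
  · rw [sign_erase_of_lt hg' h, sign_erase_of_not_lt σ (not_lt.2 h.le)]
    ring

end Sign

section Divisors

variable {n : ℕ} {ι : Type*} [Fintype ι] (m : ι → Fin n →₀ ℕ)

/-- The indices of the monomials dividing `v`. -/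
noncomputable def divisors (v : Fin n →₀ ℕ) : Finset ι :=
  open Classical in Finset.univ.filter fun g => m g ≤ v

theorem mem_divisors {v : Fin n →₀ ℕ} {g : ι} : g ∈ divisors m v ↔ m g ≤ v := by
  simp [divisors]

end Divisors

section Complex

variable {K : Type*} [Field K] {n : ℕ} {ι : Type*} [LinearOrder ι]

/-- The element of multidegree `v` with support `σ` in the Taylor complex. -/
noncomputable def elt (K : Type*) [Field K] {n : ℕ} {ι : Type*} [LinearOrder ι]
    (m : ι → Fin n →₀ ℕ) (v : Fin n →₀ ℕ) (σ : Finset ι) : Finset ι → MvPolynomial (Fin n) K :=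
  Pi.single σ (monomial (v - σ.sup m) 1)

variable (m : ι → Fin n →₀ ℕ)

theorem monomial_smul_elt (u v : Fin n →₀ ℕ) (σ : Finset ι) (h : σ.sup m ≤ v) :
    (monomial u 1 : MvPolynomial (Fin n) K) • elt K m v σ = elt K m (u + v) σ := by
  rw [elt, elt, ← Pi.single_smul, smul_eq_mul, monomial_mul, one_mul, add_tsub_assoc_of_le h]

theorem elt_eq_smul (v : Fin n →₀ ℕ) (σ : Finset ι) :
    elt K m v σ = (monomial (v - σ.sup m) 1 : MvPolynomial (Fin n) K) • Pi.single σ 1 := by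
  rw [elt, ← Pi.single_smul, smul_eq_mul, mul_one]

theorem single_monomial_eq_elt (u : Fin n →₀ ℕ) (σ : Finset ι) :
    (Pi.single σ (monomial u 1) : Finset ι → MvPolynomial (Fin n) K) =
      elt K m (u + σ.sup m) σ := by
  rw [elt, add_tsub_cancel_right]

theorem sup_erase_le (σ : Finset ι) (g : ι) : (σ.erase g).sup m ≤ σ.sup m :=
  Finset.sup_mono (Finset.erase_subset _ _)

/-- The part of homological degree `i` of the Taylor complex. -/
def part (K : Type*) [Field K] (n : ℕ) (ι : Type*) (i : ℕ) :
    Submodule (MvPolynomial (Fin n) K) (Finset ι → MvPolynomial (Fin n) K) where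
  carrier := {t | ∀ σ, ¬ σ.card = i → t σ = 0}
  add_mem' hs ht σ hσ := by rw [Pi.add_apply, hs σ hσ, ht σ hσ, add_zero]
  zero_mem' _ _ := rfl
  smul_mem' c t ht σ hσ := by rw [Pi.smul_apply, ht σ hσ, smul_zero]

theorem elt_mem_part (v : Fin n →₀ ℕ) (σ : Finset ι) : elt K m v σ ∈ part K n ι σ.card := by
  intro τ hτ
  rw [elt, Pi.single_eq_of_ne]
  rintro rfl
  exact hτ rfl

variable [Fintype ι]

/-- The differential of the Taylor complex of the monomials `m`. -/
noncomputable def d (K : Type*) [Field K] {n : ℕ} {ι : Type*} [Fintype ι] [LinearOrder ι]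
    (m : ι → Fin n →₀ ℕ) :
    (Finset ι → MvPolynomial (Fin n) K) →ₗ[MvPolynomial (Fin n) K]
      (Finset ι → MvPolynomial (Fin n) K) :=
  (Pi.basisFun _ (Finset ι)).constr ℕ fun σ => ∑ g ∈ σ, sign g σ • elt K m (σ.sup m) (σ.erase g)

theorem d_single_one (σ : Finset ι) :
    d K m (Pi.single σ 1) = ∑ g ∈ σ, sign g σ • elt K m (σ.sup m) (σ.erase g) := by
  rw [d, ← Pi.basisFun_apply, Module.Basis.constr_basis]

/-- In a fixed multidegree `v` the monomial coefficients disappear and the differential is the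
simplicial boundary. -/
theorem d_elt {v : Fin n →₀ ℕ} {σ : Finset ι} (h : σ.sup m ≤ v) :
    d K m (elt K m v σ) = ∑ g ∈ σ, sign g σ • elt K m v (σ.erase g) := by
  rw [elt_eq_smul, map_smul, d_single_one, Finset.smul_sum]
  refine Finset.sum_congr rfl fun g _ => ?_
  rw [smul_comm, monomial_smul_elt m _ _ _ (sup_erase_le m σ g), tsub_add_cancel_of_le h]

theorem d_d_elt {v : Fin n →₀ ℕ} {σ : Finset ι} (h : σ.sup m ≤ v) :
    d K m (d K m (elt K m v σ)) = 0 := by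
  rw [d_elt m h, map_sum]
  have : ∀ g ∈ σ, d K m (sign g σ • elt K m v (σ.erase g)) =
      ∑ g' ∈ σ.erase g, (sign g σ * sign g' (σ.erase g)) • elt K m v ((σ.erase g).erase g') := by
    intro g _
    rw [map_zsmul, d_elt m ((sup_erase_le m σ g).trans h), Finset.smul_sum]
    exact Finset.sum_congr rfl fun g' _ => smul_smul _ _ _
  rw [Finset.sum_congr rfl this, Finset.sum_sigma']
  -- The terms cancel in pairs under exchanging the order of the two deletions.
  refine Finset.sum_involution (fun x _ => ⟨x.2, x.1⟩) ?_ ?_ ?_ ?_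
  · rintro ⟨g, g'⟩ hx
    simp only [Finset.mem_sigma, Finset.mem_erase] at hx
    simp only
    rw [Finset.erase_right_comm (a := g'), ← add_smul,
      sign_mul_sign_add hx.1 hx.2.2 (Ne.symm hx.2.1), zero_smul]
  · rintro ⟨g, g'⟩ hx _ he
    simp only [Finset.mem_sigma, Finset.mem_erase] at hx
    exact hx.2.1 (congrArg Sigma.fst he)
  · rintro ⟨g, g'⟩ hx
    simp only [Finset.mem_sigma, Finset.mem_erase] at hx ⊢
    exact ⟨hx.2.2, Ne.symm hx.2.1, hx.1⟩
  · rintro ⟨g, g'⟩ _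
    rfl

theorem d_d (t : Finset ι → MvPolynomial (Fin n) K) : d K m (d K m t) = 0 := by
  have : d K m ∘ₗ d K m = 0 := by
    refine (Pi.basisFun _ (Finset ι)).ext fun σ => ?_
    rw [Pi.basisFun_apply, LinearMap.comp_apply, LinearMap.zero_apply]
    have h := d_d_elt (K := K) m (le_refl (σ.sup m))
    rwa [elt, tsub_self] at h
  exact LinearMap.congr_fun this t

/-- The contracting homotopy in multidegree `v`: the vertex of least index is added. -/
noncomputable def homotopyElt (K : Type*) [Field K] {n : ℕ} {ι : Type*} [Fintype ι] [LinearOrder ι]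
    (m : ι → Fin n →₀ ℕ) (v : Fin n →₀ ℕ) (σ : Finset ι) :
    Finset ι → MvPolynomial (Fin n) K :=
  if h : (divisors m v).Nonempty then
    if (divisors m v).min' h ∈ σ then 0 else elt K m v (insert ((divisors m v).min' h) σ)
  else 0

/-- The `K`-linear contracting homotopy of the Taylor complex. -/
noncomputable def homotopy (K : Type*) [Field K] {n : ℕ} {ι : Type*} [Fintype ι] [LinearOrder ι]
    (m : ι → Fin n →₀ ℕ) :
    (Finset ι → MvPolynomial (Fin n) K) →ₗ[K] (Finset ι → MvPolynomial (Fin n) K) :=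
  (Pi.basis fun _ : Finset ι => basisMonomials (Fin n) K).constr ℕ
    fun x => homotopyElt K m (x.2 + x.1.sup m) x.1

theorem homotopy_single_monomial (u : Fin n →₀ ℕ) (σ : Finset ι) :
    homotopy K m (Pi.single σ (monomial u 1)) = homotopyElt K m (u + σ.sup m) σ := by
  have := (Pi.basis fun _ : Finset ι => basisMonomials (Fin n) K).constr_basis ℕ
    (fun x => homotopyElt K m (x.2 + x.1.sup m) x.1) ⟨σ, u⟩
  rwa [Pi.basis_apply, coe_basisMonomials] at this

theorem homotopy_elt {v : Fin n →₀ ℕ} {σ : Finset ι} (h : σ.sup m ≤ v) :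
    homotopy K m (elt K m v σ) = homotopyElt K m v σ := by
  rw [elt, homotopy_single_monomial, tsub_add_cancel_of_le h]

/-- In multidegree `v` the complex is that of the full simplex on `divisors m v`, a cone over its
least vertex. A nonempty `σ` guarantees that this vertex exists. -/
theorem homotopy_identity_elt {v : Fin n →₀ ℕ} {σ : Finset ι} (h : σ.sup m ≤ v)
    (hσ : σ.Nonempty) :
    d K m (homotopy K m (elt K m v σ)) + homotopy K m (d K m (elt K m v σ)) = elt K m v σ := by
  have hdiv : σ ⊆ divisors m v := fun g hg => (mem_divisors m).2 ((Finset.le_sup hg).trans h)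
  have hne := hσ.mono hdiv
  obtain ⟨g, hg⟩ : ∃ g, g = (divisors m v).min' hne := ⟨_, rfl⟩
  have hgv : m g ≤ v := (mem_divisors m).1 (hg ▸ Finset.min'_mem _ _)
  have hle : ∀ i ∈ σ, g ≤ i := fun i hi => hg ▸ Finset.min'_le _ _ (hdiv hi)
  have hE : ∀ τ, homotopyElt K m v τ = if g ∈ τ then 0 else elt K m v (insert g τ) := by
    intro τ
    rw [homotopyElt, dif_pos hne, ← hg]
  have hd : homotopy K m (d K m (elt K m v σ)) = ∑ i ∈ σ, sign i σ •
      (if g ∈ σ.erase i then 0 else elt K m v (insert g (σ.erase i))) := by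
    rw [d_elt m h, map_sum]
    refine Finset.sum_congr rfl fun i _ => ?_
    rw [map_zsmul, homotopy_elt m ((sup_erase_le m σ i).trans h), hE]
  rw [hd, homotopy_elt m h, hE]
  -- If `g ∈ σ`, only the face without `g` survives, with sign 1. Otherwise the boundary of the cone
  -- contributes `σ`, and its other faces cancel, since inserting the least vertex flips their
  -- signs.
  by_cases hgσ : g ∈ σ
  · rw [if_pos hgσ, map_zero, zero_add, Finset.sum_eq_single_of_mem g hgσ, sign_of_le hle,
      if_neg (Finset.notMem_erase _ _), Finset.insert_erase hgσ, one_smul]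
    intro i _ hi
    rw [if_pos (Finset.mem_erase.2 ⟨Ne.symm hi, hgσ⟩), smul_zero]
  · have hle' : ∀ i ∈ insert g σ, g ≤ i := by
      simpa using hle
    rw [if_neg hgσ, d_elt m (by rw [Finset.sup_insert]; exact sup_le hgv h),
      Finset.sum_insert hgσ, sign_of_le hle', Finset.erase_insert hgσ, one_smul, add_assoc,
      ← Finset.sum_add_distrib, Finset.sum_eq_zero, add_zero]
    intro i hi
    have hgi : g ≠ i := fun e => hgσ (e ▸ hi)
    have hlt : g < i := lt_of_le_of_ne (hle i hi) hgi
    rw [if_neg (fun h => hgσ (Finset.mem_of_mem_erase h)),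
      sign_erase_of_lt (Finset.mem_insert_self g σ) hlt, Finset.erase_insert hgσ,
      Finset.erase_insert_of_ne hgi, neg_smul, neg_add_cancel]

/-- A linear map is determined by its values on the supporting monomial basis elements. -/
theorem map_mem_of_forall_monomial {A : Type*} [AddCommGroup A] [Module K A]
    (P : Finset ι → Prop) (f : (Finset ι → MvPolynomial (Fin n) K) →ₗ[K] A) (V : Submodule K A)
    (hf : ∀ σ u, P σ → f (Pi.single σ (monomial u 1)) ∈ V)
    {t : Finset ι → MvPolynomial (Fin n) K} (ht : ∀ σ, ¬ P σ → t σ = 0) : f t ∈ V := by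
  rw [← Finset.univ_sum_single t, map_sum]
  refine Submodule.sum_mem _ fun σ _ => ?_
  by_cases hσ : P σ
  · induction t σ using MvPolynomial.induction_on' with
    | monomial u c =>
      have : (Pi.single σ (monomial u c) : Finset ι → MvPolynomial (Fin n) K) =
          c • Pi.single σ (monomial u 1) := by
        rw [← Pi.single_smul, smul_monomial, smul_eq_mul, mul_one]
      rw [this, map_smul]
      exact V.smul_mem _ (hf σ u hσ)
    | add p q hp hq =>
      rw [Pi.single_add, map_add]
      exact V.add_mem hp hq
  · rw [ht σ hσ, Pi.single_zero, map_zero]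
    exact V.zero_mem

theorem d_mem_part {i : ℕ} {t : Finset ι → MvPolynomial (Fin n) K} (ht : t ∈ part K n ι (i + 1)) :
    d K m t ∈ part K n ι i := by
  refine map_mem_of_forall_monomial (K := K) (fun σ => σ.card = i + 1)
    ((d K m).restrictScalars K) ((part K n ι i).restrictScalars K) (fun σ u hσ => ?_) ht
  rw [single_monomial_eq_elt m, LinearMap.restrictScalars_apply, d_elt m le_add_self]
  refine Submodule.sum_mem _ fun g hg => zsmul_mem ?_ _
  have := elt_mem_part (K := K) m (u + σ.sup m) (σ.erase g)
  rwa [Finset.card_erase_of_mem hg, hσ] at this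

theorem homotopy_mem_part {i : ℕ} {t : Finset ι → MvPolynomial (Fin n) K}
    (ht : t ∈ part K n ι i) : homotopy K m t ∈ part K n ι (i + 1) := by
  refine map_mem_of_forall_monomial (K := K) (fun σ => σ.card = i)
    (homotopy K m) ((part K n ι (i + 1)).restrictScalars K) (fun σ u hσ => ?_) ht
  rw [homotopy_single_monomial, homotopyElt]
  split_ifs with h1 h2
  · exact Submodule.zero_mem _
  · have := elt_mem_part (K := K) m (u + σ.sup m) (insert ((divisors m (u + σ.sup m)).min' h1) σ)
    rwa [Finset.card_insert_of_notMem h2, hσ] at this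
  · exact Submodule.zero_mem _

theorem homotopy_identity {i : ℕ} {t : Finset ι → MvPolynomial (Fin n) K}
    (ht : t ∈ part K n ι (i + 1)) :
    d K m (homotopy K m t) + homotopy K m (d K m t) = t := by
  have := map_mem_of_forall_monomial (K := K) (fun σ => σ.card = i + 1)
    ((d K m).restrictScalars K ∘ₗ homotopy K m + homotopy K m ∘ₗ (d K m).restrictScalars K -
      LinearMap.id) ⊥ (fun σ u hσ => by
        rw [Submodule.mem_bot, single_monomial_eq_elt m, LinearMap.sub_apply, sub_eq_zero]
        exact homotopy_identity_elt m le_add_self (Finset.card_pos.1 (by omega))) ht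
  rw [Submodule.mem_bot, LinearMap.sub_apply, sub_eq_zero] at this
  exact this

theorem d_apply_mem_of_forall_single (I : Ideal (MvPolynomial (Fin n) K)) (τ : Finset ι)
    (h : ∀ σ, d K m (Pi.single σ 1) τ ∈ I) (t : Finset ι → MvPolynomial (Fin n) K) :
    d K m t τ ∈ I := by
  rw [← (Pi.basisFun (MvPolynomial (Fin n) K) (Finset ι)).sum_repr t, map_sum, Finset.sum_apply]
  refine Ideal.sum_mem _ fun σ _ => ?_
  rw [map_smul, Pi.smul_apply, Pi.basisFun_apply]
  exact I.mul_mem_left _ (h σ)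

/-- The entries of the Taylor differential are, up to sign, sums of quotients of least common
multiples. -/
theorem d_single_one_apply_mem {G : Type*} [SetLike G (MvPolynomial (Fin n) K)]
    [AddSubgroupClass G (MvPolynomial (Fin n) K)] (I : G) (σ τ : Finset ι)
    (h : ∀ g ∈ σ, σ.erase g = τ → (monomial (σ.sup m - τ.sup m) 1 : MvPolynomial (Fin n) K) ∈ I) :
    d K m (Pi.single σ 1) τ ∈ I := by
  rw [d_single_one, Finset.sum_apply]
  refine sum_mem fun g hg => ?_
  rw [Pi.smul_apply]
  refine zsmul_mem ?_ _
  by_cases hτ : σ.erase g = τ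
  · rw [elt, hτ, Pi.single_eq_same]
    exact h g hg hτ
  · rw [elt, Pi.single_eq_of_ne (Ne.symm hτ)]
    exact zero_mem _

/-- Only singletons have `∅` as a facet, and the coefficient there is the generator itself. -/
theorem d_apply_empty_mem (t : Finset ι → MvPolynomial (Fin n) K) :
    d K m t ∅ ∈ Ideal.span (Set.range fun g => (monomial (m g) 1 : MvPolynomial (Fin n) K)) := by
  refine d_apply_mem_of_forall_single m _ _ (fun σ => ?_) t
  refine d_single_one_apply_mem m _ _ _ fun g hg h => Ideal.subset_span ⟨g, ?_⟩
  have : σ = {g} := by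
    rw [← Finset.insert_erase hg, h, insert_empty_eq]
  simp [this, bot_eq_zero]

theorem exists_d_eq_single_empty {p : MvPolynomial (Fin n) K}
    (hp : p ∈ Ideal.span (Set.range fun g => (monomial (m g) 1 : MvPolynomial (Fin n) K))) :
    ∃ t ∈ part K n ι 1, d K m t = Pi.single ∅ p := by
  have : Ideal.span (Set.range fun g => (monomial (m g) 1 : MvPolynomial (Fin n) K)) ≤
      Submodule.comap (LinearMap.single _ _ (∅ : Finset ι)) ((part K n ι 1).map (d K m)) := by
    rw [Ideal.span_le]
    rintro _ ⟨g, rfl⟩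
    refine ⟨elt K m (m g) {g}, elt_mem_part m (m g) {g}, ?_⟩
    rw [d_elt m (by simp), Finset.sum_singleton, sign_of_le (by simp), one_smul]
    simp [elt, bot_eq_zero]
  exact this hp

end Complex

/-! ### Numbering the faces of each size, to obtain free modules of finite rank. -/

section Faces

variable {K : Type*} [Field K] {n : ℕ} {ι : Type*} [Fintype ι]

/-- The subset of size `i` with a given index. -/
noncomputable def face (ι : Type*) [Fintype ι] (i : ℕ)
    (a : Fin (Fintype.card {σ : Finset ι // σ.card = i})) : Finset ι :=
  ((Fintype.equivFin {σ : Finset ι // σ.card = i}).symm a).1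

theorem card_face (i : ℕ) (a) : (face ι i a).card = i :=
  ((Fintype.equivFin {σ : Finset ι // σ.card = i}).symm a).2

theorem face_injective (i : ℕ) : Function.Injective (face ι i) :=
  Subtype.val_injective.comp (Equiv.injective _)

theorem exists_face_eq {i : ℕ} {σ : Finset ι} (h : σ.card = i) : ∃ a, face ι i a = σ :=
  ⟨Fintype.equivFin {σ : Finset ι // σ.card = i} ⟨σ, h⟩, by simp [face]⟩

/-- Extension by zero to the whole Taylor complex. -/
noncomputable def extend (S : Type*) [CommRing S] (ι : Type*) [Fintype ι] (i : ℕ) :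
    (Fin (Fintype.card {σ : Finset ι // σ.card = i}) → S) →ₗ[S] (Finset ι → S) :=
  Function.ExtendByZero.linearMap S (face ι i)

/-- Restriction to homological degree `i`. -/
noncomputable def restrict (S : Type*) [CommRing S] (ι : Type*) [Fintype ι] (i : ℕ) :
    (Finset ι → S) →ₗ[S] (Fin (Fintype.card {σ : Finset ι // σ.card = i}) → S) :=
  LinearMap.funLeft S S (face ι i)

theorem face_zero (a) : face ι 0 a = ∅ := Finset.card_eq_zero.1 (card_face 0 a)

theorem extend_face {S : Type*} [CommRing S] (i : ℕ) (w) (a) :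
    extend S ι i w (face ι i a) = w a :=
  (face_injective i).extend_apply _ _ _

theorem extend_mem_part (i : ℕ) (w) : extend (MvPolynomial (Fin n) K) ι i w ∈ part K n ι i := by
  intro σ hσ
  refine Function.extend_apply' _ _ _ ?_
  rintro ⟨a, rfl⟩
  exact hσ (card_face i a)

theorem restrict_apply {S : Type*} [CommRing S] (i : ℕ) (t : Finset ι → S) (a) :
    restrict S ι i t a = t (face ι i a) := rfl

theorem restrict_extend {S : Type*} [CommRing S] (i : ℕ) (w) :
    restrict S ι i (extend S ι i w) = w :=
  funext fun a => extend_face i w a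

theorem extend_restrict {i : ℕ} {t : Finset ι → MvPolynomial (Fin n) K} (ht : t ∈ part K n ι i) :
    extend _ ι i (restrict _ ι i t) = t := by
  ext1 σ
  by_cases h : σ.card = i
  · obtain ⟨a, rfl⟩ := exists_face_eq h
    rw [extend_face, restrict_apply]
  · rw [ht σ h, extend_mem_part i _ σ h]

/-- The augmentation of the Taylor resolution. -/
noncomputable def aug (K : Type*) [Field K] (n : ℕ) (ι : Type*) [Fintype ι]
    (M : Ideal (MvPolynomial (Fin n) K)) :
    (Fin (Fintype.card {σ : Finset ι // σ.card = 0}) → MvPolynomial (Fin n) K)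
      →ₗ[MvPolynomial (Fin n) K] (MvPolynomial (Fin n) K ⧸ M) :=
  M.mkQ ∘ₗ LinearMap.proj ∅ ∘ₗ extend _ ι 0

theorem aug_apply (M : Ideal (MvPolynomial (Fin n) K)) (w) :
    aug K n ι M w = Ideal.Quotient.mk M (extend _ ι 0 w ∅) := rfl

variable [DecidableEq ι]

theorem extend_single (i : ℕ) (a) (p : MvPolynomial (Fin n) K) :
    extend (MvPolynomial (Fin n) K) ι i (Pi.single a p) = Pi.single (face ι i a) p := by
  have : (Pi.single (face ι i a) p : Finset ι → MvPolynomial (Fin n) K) ∈ part K n ι i := by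
    intro τ hτ
    rw [Pi.single_eq_of_ne]
    rintro rfl
    exact hτ (card_face i a)
  rw [← extend_restrict this]
  congr 1
  ext1 b
  simp only [restrict_apply, Pi.single_apply, (face_injective i).eq_iff]

theorem aug_restrict_single (M : Ideal (MvPolynomial (Fin n) K)) (p : MvPolynomial (Fin n) K) :
    aug K n ι M (restrict _ ι 0 (Pi.single ∅ p)) = Ideal.Quotient.mk M p := by
  rw [aug_apply, extend_restrict, Pi.single_eq_same]
  intro τ hτ
  rw [Pi.single_eq_of_ne]
  rintro rfl
  exact hτ rfl

end Faces

section Monomials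

variable {K : Type*} [Field K] {n : ℕ}

theorem polyPart_sub_degree {u v : Fin n →₀ ℕ} (h : v ≤ u) :
    (monomial (u - v) 1 : MvPolynomial (Fin n) K) ∈ polyPart K n (u.degree - v.degree) := by
  have := monomial_mem_polyPart (K := K) (u - v) 1
  have e : (u - v).degree + v.degree = u.degree := by
    rw [← map_add, tsub_add_cancel_of_le h]
  rwa [← e, Nat.cast_add, add_sub_cancel_right]

theorem monomial_mem_span_X {u : Fin n →₀ ℕ} (hu : u ≠ 0) :
    (monomial u 1 : MvPolynomial (Fin n) K) ∈
      Ideal.span (Set.range (X : Fin n → MvPolynomial (Fin n) K)) := by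
  classical
  rw [← Set.image_univ, mem_ideal_span_X_image]
  intro v hv
  rw [mem_support_iff, coeff_monomial] at hv
  split_ifs at hv with h
  · obtain ⟨i, hi⟩ := DFunLike.ne_iff.1 hu
    exact ⟨i, trivial, h ▸ hi⟩
  · exact absurd rfl hv

end Monomials

/-! ### Assembling the minimal resolution and reading off Betti numbers. -/

section Resolution

variable {K : Type*} [Field K] {n : ℕ} {ι : Type*} [Fintype ι] [LinearOrder ι]
  (m : ι → Fin n →₀ ℕ)

/-- The Taylor resolution of a monomial ideal, which is minimal if no generator divides the least
common multiple of some others. -/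
noncomputable def resolution (M : Ideal (MvPolynomial (Fin n) K))
    (hM : M = Ideal.span (Set.range fun g => (monomial (m g) 1 : MvPolynomial (Fin n) K)))
    (hm : ∀ σ : Finset ι, ∀ g ∈ σ, (σ.erase g).sup m ≠ σ.sup m) :
    MinimalGradedFreeResolution K n (quotientPart M) where
  rank i := Fintype.card {σ : Finset ι // σ.card = i}
  deg i a := ((face ι i a).sup m).degree
  d i := restrict _ ι i ∘ₗ d K m ∘ₗ extend _ ι (i + 1)
  aug := aug K n ι M
  d_homogeneous i b a := by
    rw [LinearMap.comp_apply, LinearMap.comp_apply, extend_single, restrict_apply]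
    refine d_single_one_apply_mem m _ _ _ fun g _ h => polyPart_sub_degree ?_
    exact h ▸ sup_erase_le m _ _
  aug_homogeneous a := by
    rw [aug_apply, extend_single, face_zero, Pi.single_eq_same]
    refine Submodule.mem_map.2 ⟨1, ?_, rfl⟩
    simpa [bot_eq_zero] using monomial_mem_polyPart (K := K) (0 : Fin n →₀ ℕ) 1
  aug_surjective x := by
    obtain ⟨p, rfl⟩ := Ideal.Quotient.mk_surjective x
    exact ⟨_, aug_restrict_single M p⟩
  exact_zero w := by
    rw [aug_apply, Ideal.Quotient.eq_zero_iff_mem]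
    constructor
    · intro h
      obtain ⟨t, ht, hd⟩ := exists_d_eq_single_empty m (hM ▸ h)
      refine ⟨restrict _ ι 1 t, ?_⟩
      rw [LinearMap.comp_apply, LinearMap.comp_apply, extend_restrict ht, hd]
      ext1 a
      rw [restrict_apply, face_zero, Pi.single_eq_same, ← face_zero a, extend_face]
    · rintro ⟨u, rfl⟩
      rw [LinearMap.comp_apply, LinearMap.comp_apply,
        extend_restrict (d_mem_part m (extend_mem_part _ _)), hM]
      exact d_apply_empty_mem m _
  exact_succ i w := by
    constructor
    · intro h
      rw [LinearMap.comp_apply, LinearMap.comp_apply] at h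
      have h0 : d K m (extend _ ι (i + 1) w) = 0 := by
        rw [← extend_restrict (d_mem_part m (extend_mem_part _ _)), h, map_zero]
      have h1 := homotopy_identity m (extend_mem_part (K := K) (n := n) (ι := ι) (i + 1) w)
      rw [h0, map_zero, add_zero] at h1
      refine ⟨restrict _ ι (i + 1 + 1) (homotopy K m (extend _ ι (i + 1) w)), ?_⟩
      rw [LinearMap.comp_apply, LinearMap.comp_apply,
        extend_restrict (homotopy_mem_part m (extend_mem_part _ _)), h1, restrict_extend]
    · rintro ⟨u, rfl⟩
      simp only [LinearMap.comp_apply]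
      rw [extend_restrict (d_mem_part m (extend_mem_part _ _)), d_d, map_zero]
  minimal i v a := by
    rw [LinearMap.comp_apply, LinearMap.comp_apply, restrict_apply]
    refine d_apply_mem_of_forall_single m _ _ (fun σ => ?_) _
    -- An entry could be a nonzero constant only if deleting `g` left the lcm unchanged, which `hm`
    -- excludes.
    refine d_single_one_apply_mem m _ _ _ fun g hg h => monomial_mem_span_X ?_
    rw [← h]
    intro h0
    exact hm σ g hg (le_antisymm (sup_erase_le m σ g) (tsub_eq_zero_iff_le.1 h0))

/-- Supplies the hypothesis on the target resolution in `betti_ne_zero_congr`. -/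
theorem resolution_aug_lift (M : Ideal (MvPolynomial (Fin n) K))
    (hM : M = Ideal.span (Set.range fun g => (monomial (m g) 1 : MvPolynomial (Fin n) K)))
    (hm : ∀ σ : Finset ι, ∀ g ∈ σ, (σ.erase g).sup m ≠ σ.sup m) (j : ℤ)
    (x : MvPolynomial (Fin n) K ⧸ M) (hx : x ∈ quotientPart M j) :
    ∃ w, IsFreeHomogeneous ((resolution m M hM hm).deg 0) j w ∧
      (resolution m M hM hm).aug w = x := by
  obtain ⟨p, hp, rfl⟩ := Submodule.mem_map.1 hx
  refine ⟨restrict _ ι 0 (Pi.single ∅ p), fun a => ?_, aug_restrict_single M p⟩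
  change (Pi.single ∅ p : Finset ι → MvPolynomial (Fin n) K) (face ι 0 a) ∈
    polyPart K n (j - ((face ι 0 a).sup m).degree)
  have h : face ι 0 a = ∅ := face_zero a
  rw [h, Pi.single_eq_same]
  simpa [bot_eq_zero] using hp

/-- The degrees in which the graded Betti numbers of a monomial ideal with minimal Taylor
resolution do not vanish. -/
theorem betti_ne_zero_iff (M : Ideal (MvPolynomial (Fin n) K))
    (hM : M = Ideal.span (Set.range fun g => (monomial (m g) 1 : MvPolynomial (Fin n) K)))
    (hm : ∀ σ : Finset ι, ∀ g ∈ σ, (σ.erase g).sup m ≠ σ.sup m)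
    (F : MinimalGradedFreeResolution K n (quotientPart M)) (i : ℕ) (j : ℤ) :
    F.betti i j ≠ 0 ↔ ∃ σ : Finset ι, σ.card = i ∧ ((σ.sup m).degree : ℤ) = j := by
  rw [F.betti_ne_zero_congr _ (resolution_aug_lift m M hM hm),
    MinimalGradedFreeResolution.betti_ne_zero_iff]
  constructor
  · rintro ⟨a, ha⟩
    exact ⟨face ι i a, card_face i a, ha⟩
  · rintro ⟨σ, hσ, h⟩
    obtain ⟨a, rfl⟩ := exists_face_eq hσ
    exact ⟨a, h⟩

end Resolution

end Taylor

/-! ### Heights of ideals generated by variables. -/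

section HeightOfVariables

variable {K : Type*} [Field K] {n : ℕ}

/-- The ideal is the kernel of the substitution `φ` of 0 for the variables in `s`, an endomorphism
of a domain; modulo the ideal, `φ` is the identity. -/
theorem isPrime_span_X_image (s : Set (Fin n)) :
    (Ideal.span ((X : Fin n → MvPolynomial (Fin n) K) '' s)).IsPrime := by
  classical
  obtain ⟨φ, hφ⟩ : ∃ φ : MvPolynomial (Fin n) K →ₐ[K] MvPolynomial (Fin n) K,
      φ = aeval fun i => if i ∈ s then 0 else X i := ⟨_, rfl⟩
  have h : Ideal.span ((X : Fin n → MvPolynomial (Fin n) K) '' s) = RingHom.ker φ := by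
    apply le_antisymm
    · rw [Ideal.span_le]
      rintro _ ⟨i, hi, rfl⟩
      rw [SetLike.mem_coe, RingHom.mem_ker, hφ, aeval_X, if_pos hi]
    · intro p hp
      rw [RingHom.mem_ker] at hp
      have e : (Ideal.Quotient.mkₐ K
          (Ideal.span ((X : Fin n → MvPolynomial (Fin n) K) '' s))).comp φ =
          Ideal.Quotient.mkₐ K (Ideal.span ((X : Fin n → MvPolynomial (Fin n) K) '' s)) := by
        refine MvPolynomial.algHom_ext fun i => ?_
        rw [AlgHom.comp_apply, hφ, aeval_X]
        split_ifs with hi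
        · rw [map_zero, eq_comm, Ideal.Quotient.mkₐ_eq_mk, Ideal.Quotient.eq_zero_iff_mem]
          exact Ideal.subset_span ⟨i, hi, rfl⟩
        · rfl
      have := DFunLike.congr_fun e p
      rwa [AlgHom.comp_apply, hp, map_zero, eq_comm, Ideal.Quotient.mkₐ_eq_mk,
        Ideal.Quotient.eq_zero_iff_mem] at this
  rw [h]
  exact RingHom.ker_isPrime _

/-- Adding the variables one at a time gives a strict chain of primes. -/
theorem card_le_height_span_X (s : Finset (Fin n)) :
    (s.card : ℕ∞) ≤ (Ideal.span ((X : Fin n → MvPolynomial (Fin n) K) '' s)).height := by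
  classical
  induction s using Finset.induction_on with
  | empty => simp
  | insert a s ha ih =>
    have h1 := isPrime_span_X_image (K := K) (s : Set (Fin n))
    have h2 := isPrime_span_X_image (K := K) ((insert a s : Finset (Fin n)) : Set (Fin n))
    rw [Finset.card_insert_of_notMem ha, Nat.cast_add, Nat.cast_one]
    refine (add_le_add_left ih 1).trans (Ideal.height_add_one_le_of_lt_of_isPrime ?_)
    refine lt_of_le_of_ne (Ideal.span_mono (Set.image_mono (by simp))) fun e => ?_
    have ha' : (X a : MvPolynomial (Fin n) K) ∈
        Ideal.span ((X : Fin n → MvPolynomial (Fin n) K) '' s) := by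
      rw [e]
      exact Ideal.subset_span ⟨a, by simp, rfl⟩
    rw [mem_ideal_span_X_image] at ha'
    obtain ⟨i, hi, h⟩ := ha' (Finsupp.single a 1) (by simp [support_X])
    rw [Finsupp.single_apply] at h
    split_ifs at h with hai
    · exact ha (hai ▸ hi)
    · exact h rfl

/-- The upper bound is Krull's height theorem. -/
theorem height_span_X (s : Finset (Fin n)) :
    (Ideal.span ((X : Fin n → MvPolynomial (Fin n) K) '' s)).height = s.card := by
  classical
  refine le_antisymm ?_ (card_le_height_span_X s)
  have h1 := isPrime_span_X_image (K := K) (s : Set (Fin n))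
  refine (Ideal.height_le_spanFinrank _ h1.ne_top).trans (Nat.cast_le.2 ?_)
  refine (Submodule.spanFinrank_span_le_ncard_of_finite (s.finite_toSet.image _)).trans ?_
  refine (Set.ncard_image_le s.finite_toSet).trans ?_
  rw [Set.ncard_coe_finset]

end HeightOfVariables

/-! ### Growth of the degree of the lcm. -/

section DegreeOfLcm

variable {n : ℕ}

theorem degree_lt_degree_of_lt {u v : Fin n →₀ ℕ} (h : u < v) : u.degree < v.degree := by
  have e : u.degree + (v - u).degree = v.degree := by
    rw [← map_add, add_tsub_cancel_of_le h.le]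
  have : (v - u).degree ≠ 0 := by
    rw [Ne, Finsupp.degree_eq_zero_iff, tsub_eq_zero_iff_le]
    exact not_le_of_gt h
  omega

/-- If every monomial strictly enlarges the least common multiple of others, then the degree of a
least common multiple minus the number of monomials is monotone. -/
theorem degree_sup_add_card_le {ι : Type*} [DecidableEq ι] {m : ι → Fin n →₀ ℕ}
    (hm : ∀ σ : Finset ι, ∀ g ∈ σ, (σ.erase g).sup m ≠ σ.sup m) {σ τ : Finset ι} (h : σ ⊆ τ) :
    (σ.sup m).degree + τ.card ≤ (τ.sup m).degree + σ.card := by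
  induction τ using Finset.strongInduction with
  | H τ ih =>
    rcases h.eq_or_ssubset with rfl | hs
    · rfl
    · obtain ⟨g, hgτ, hgσ⟩ := Finset.exists_of_ssubset hs
      have h1 := ih (τ.erase g) (Finset.erase_ssubset hgτ) (Finset.subset_erase.2 ⟨h, hgσ⟩)
      have h2 := degree_lt_degree_of_lt (lt_of_le_of_ne
        (Finset.sup_mono (Finset.erase_subset g τ)) (hm τ g hgτ))
      have h3 := Finset.card_erase_add_one hgτ
      omega

end DegreeOfLcm

/-! ### Combinatorics of quadratic dominant generating sets, and the height of their ideals. -/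

section QuadraticDominant

variable {n : ℕ} {G : Finset (Fin n →₀ ℕ)}

/-- `y m` and `z m` are the variables whose product is `m`, for each `m ∈ G`, where `y m`
witnesses the dominance of `m`. -/
structure IsDominantFactorization (G : Finset (Fin n →₀ ℕ)) (y z : G → Fin n) : Prop where
  eq_add : ∀ m : G, (m : Fin n →₀ ℕ) = Finsupp.single (y m) 1 + Finsupp.single (z m) 1
  lt : ∀ m m' : G, m' ≠ m → (m' : Fin n →₀ ℕ) (y m) < (m : Fin n →₀ ℕ) (y m)

theorem exists_eq_single_add {u : Fin n →₀ ℕ} {k : ℕ} {x : Fin n} (hx : u x ≠ 0)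
    (h : u.degree = k + 1) : ∃ v : Fin n →₀ ℕ, u = Finsupp.single x 1 + v ∧ v.degree = k := by
  refine ⟨u - Finsupp.single x 1, ?_⟩
  have e : u = Finsupp.single x 1 + (u - Finsupp.single x 1) :=
    (add_tsub_cancel_of_le (Finsupp.single_le_iff.2 (Nat.one_le_iff_ne_zero.2 hx))).symm
  refine ⟨e, ?_⟩
  have := congrArg Finsupp.degree e
  rw [map_add, Finsupp.degree_single] at this
  omega

theorem exists_apply_ne_zero {u : Fin n →₀ ℕ} {k : ℕ} (h : u.degree = k + 1) : ∃ x, u x ≠ 0 := by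
  refine DFunLike.ne_iff.1 fun h0 : u = 0 => ?_
  rw [h0, map_zero] at h
  omega

theorem exists_isDominantFactorization (hquadratic : ∀ m ∈ G, m.degree = 2)
    (hdominant : ∀ m ∈ G, IsDominantIn G m) : ∃ y z, IsDominantFactorization G y z := by
  have key : ∀ m : G, ∃ y z : Fin n,
      (m : Fin n →₀ ℕ) = Finsupp.single y 1 + Finsupp.single z 1 ∧
      ∀ m' : G, m' ≠ m → (m' : Fin n →₀ ℕ) y < (m : Fin n →₀ ℕ) y := by
    intro m
    obtain ⟨y, hy, hlt⟩ : ∃ y, (m : Fin n →₀ ℕ) y ≠ 0 ∧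
        ∀ m' : G, m' ≠ m → (m' : Fin n →₀ ℕ) y < (m : Fin n →₀ ℕ) y := by
      -- If `m` is the only generator, dominance is vacuous and its witness need not divide `m`, so
      -- a divisor is chosen instead.
      by_cases h : ∃ m' : G, m' ≠ m
      · obtain ⟨x, hx⟩ := hdominant m m.2
        have hx' : ∀ m' : G, m' ≠ m → (m' : Fin n →₀ ℕ) x < (m : Fin n →₀ ℕ) x :=
          fun m' hm' => hx m' m'.2 fun e => hm' (Subtype.ext e)
        obtain ⟨m', hm'⟩ := h
        exact ⟨x, (Nat.zero_lt_of_lt (hx' m' hm')).ne', hx'⟩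
      · obtain ⟨y, hy⟩ := exists_apply_ne_zero (hquadratic m m.2)
        exact ⟨y, hy, fun m' hm' => absurd ⟨m', hm'⟩ h⟩
    obtain ⟨v, hv, hv1⟩ := exists_eq_single_add hy (hquadratic m m.2)
    obtain ⟨z, hz⟩ := exists_apply_ne_zero hv1
    obtain ⟨w, hw, hw0⟩ := exists_eq_single_add hz hv1
    rw [Finsupp.degree_eq_zero_iff] at hw0
    refine ⟨y, z, ?_, hlt⟩
    rw [hv, hw, hw0, add_zero]
  choose y z h using key
  exact ⟨y, z, fun m => (h m).1, fun m => (h m).2⟩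

namespace IsDominantFactorization

variable {y z : G → Fin n}

theorem apply_eq (H : IsDominantFactorization G y z) (m : G) (x : Fin n) :
    (m : Fin n →₀ ℕ) x = (if y m = x then 1 else 0) + (if z m = x then 1 else 0) := by
  conv_lhs => rw [H.eq_add m]
  rw [Finsupp.add_apply, Finsupp.single_apply, Finsupp.single_apply]

theorem apply_ne_zero_iff (H : IsDominantFactorization G y z) (m : G) (x : Fin n) :
    (m : Fin n →₀ ℕ) x ≠ 0 ↔ y m = x ∨ z m = x := by
  rw [H.apply_eq]
  split_ifs <;> simp_all

theorem injective (H : IsDominantFactorization G y z) : Function.Injective y := by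
  intro m m' h
  by_contra hne
  have h1 := H.lt m m' (Ne.symm hne)
  have h2 := H.lt m' m hne
  rw [← h] at h2
  omega

/-- If the dominant variable of `m` occurs in another generator, then `m` is its square. -/
theorem eq_of_apply_ne_zero (H : IsDominantFactorization G y z) {m m' : G} (hne : m' ≠ m)
    (h : (m' : Fin n →₀ ℕ) (y m) ≠ 0) : z m = y m := by
  have h1 := H.lt m m' hne
  rw [H.apply_eq m, if_pos rfl] at h1
  by_contra hz
  rw [if_neg hz] at h1
  omega

/-- The exponent of `y (e g)` drops when `g` is removed. The indexing `e` is there because the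
Taylor complex needs linearly ordered indices. -/
theorem sup_erase_ne (H : IsDominantFactorization G y z) {ι : Type*} [DecidableEq ι] {e : ι → G}
    (he : Function.Injective e) (σ : Finset ι) (g : ι) (hg : g ∈ σ) :
    (σ.erase g).sup (fun i => (e i : Fin n →₀ ℕ)) ≠ σ.sup fun i => (e i : Fin n →₀ ℕ) := by
  intro h
  have h1 : (e g : Fin n →₀ ℕ) ≤ (σ.erase g).sup fun i => (e i : Fin n →₀ ℕ) :=
    h ▸ Finset.le_sup (f := fun i => (e i : Fin n →₀ ℕ)) hg
  have h2 : ∀ τ ⊆ σ.erase g, (τ.sup fun i => (e i : Fin n →₀ ℕ)) (y (e g)) <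
      (e g : Fin n →₀ ℕ) (y (e g)) := by
    intro τ
    induction τ using Finset.induction_on with
    | empty =>
      intro _
      rw [Finset.sup_empty, bot_eq_zero, Finsupp.zero_apply]
      exact Nat.pos_of_ne_zero ((H.apply_ne_zero_iff _ _).2 (Or.inl rfl))
    | insert i τ _ ih =>
      intro hτ
      rw [Finset.insert_subset_iff] at hτ
      rw [Finset.sup_insert, Finsupp.sup_apply, sup_lt_iff]
      exact ⟨H.lt _ _ fun h => (Finset.mem_erase.1 hτ.1).1 (he h), ih hτ.2⟩
  exact absurd (h1 (y (e g))) (not_le_of_gt (h2 _ subset_rfl))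

/-- The least common multiple of `G`. -/
theorem sup_eq (H : IsDominantFactorization G y z) :
    Finset.univ.sup (fun m : G => (m : Fin n →₀ ℕ)) =
      ∑ m, Finsupp.single (y m) 1 + ∑ x ∈ Finset.univ.image z, Finsupp.single x 1 := by
  have hsum : ∀ x, (∑ x ∈ Finset.univ.image z, Finsupp.single x 1 : Fin n →₀ ℕ) x =
      if x ∈ Finset.univ.image z then 1 else 0 := by
    intro x
    simp only [Finsupp.finsetSum_apply, Finsupp.single_apply, Finset.sum_ite_eq']
  refine le_antisymm (Finset.sup_le fun m _ => ?_) fun x => ?_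
  · conv_lhs => rw [H.eq_add m]
    exact add_le_add
      (Finset.single_le_sum (f := fun m => Finsupp.single (y m) 1) (fun _ _ => zero_le)
        (Finset.mem_univ m))
      (Finset.single_le_sum (f := fun x => Finsupp.single x 1) (fun _ _ => zero_le)
        (Finset.mem_image_of_mem z (Finset.mem_univ m)))
  · have hle : ∀ m : G, (m : Fin n →₀ ℕ) x ≤
        (Finset.univ.sup fun m : G => (m : Fin n →₀ ℕ)) x := fun m =>
      Finset.le_sup (f := fun m : G => (m : Fin n →₀ ℕ)) (Finset.mem_univ m) x
    rw [Finsupp.add_apply, hsum, Finsupp.finsetSum_apply]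
    -- If `x = y m` is also a value of `z`, then `m` is the square of `x` and supplies exponent 2.
    -- If `x` is no `y m`, the exponent on the right is at most 1.
    by_cases hy : ∃ m, y m = x
    · obtain ⟨m, rfl⟩ := hy
      refine le_trans ?_ (hle m)
      rw [Finset.sum_eq_single m (fun m' _ hm' => by
        rw [Finsupp.single_eq_of_ne fun h => hm' (H.injective h.symm)]) (by simp),
        Finsupp.single_eq_same, H.apply_eq, if_pos rfl]
      gcongr
      split_ifs with h1 h2 h2
      · rfl
      · exfalso
        obtain ⟨m', -, hm'⟩ := Finset.mem_image.1 h1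
        by_cases hne : m' = m
        · exact h2 (hne ▸ hm')
        · exact h2 (H.eq_of_apply_ne_zero hne ((H.apply_ne_zero_iff _ _).2 (Or.inr hm')))
      · exact zero_le
      · rfl
    · push Not at hy
      rw [Finset.sum_eq_zero fun m _ => Finsupp.single_eq_of_ne (hy m).symm, zero_add]
      split_ifs with h
      · obtain ⟨m, -, hm⟩ := Finset.mem_image.1 h
        refine le_trans ?_ (hle m)
        exact Nat.one_le_iff_ne_zero.2 ((H.apply_ne_zero_iff _ _).2 (Or.inr hm))
      · exact zero_le

theorem degree_sup_eq (H : IsDominantFactorization G y z) :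
    (Finset.univ.sup fun m : G => (m : Fin n →₀ ℕ)).degree =
      G.card + (Finset.univ.image z).card := by
  rw [H.sup_eq, map_add, map_sum, map_sum]
  simp [Finsupp.degree_single]

theorem mem_sharedVariables_iff {x : Fin n} : x ∈ sharedVariables G ↔
    ∃ m m' : G, m ≠ m' ∧ (m : Fin n →₀ ℕ) x ≠ 0 ∧ (m' : Fin n →₀ ℕ) x ≠ 0 := by
  rw [sharedVariables, Finset.mem_filter, Finset.one_lt_card]
  constructor
  · rintro ⟨-, m, hm, m', hm', h⟩
    rw [Finset.mem_filter] at hm hm'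
    exact ⟨⟨m, hm.1⟩, ⟨m', hm'.1⟩, fun e => h (congrArg Subtype.val e), hm.2, hm'.2⟩
  · rintro ⟨m, m', h, hm, hm'⟩
    exact ⟨Finset.mem_univ _, m, Finset.mem_filter.2 ⟨m.2, hm⟩, m',
      Finset.mem_filter.2 ⟨m'.2, hm'⟩, fun e => h (Subtype.ext e)⟩

theorem mem_coprimeGenerators_iff (m : G) : (m : Fin n →₀ ℕ) ∈ coprimeGenerators G ↔
    ∀ m' : G, m' ≠ m → ∀ x, (m : Fin n →₀ ℕ) x ≠ 0 → (m' : Fin n →₀ ℕ) x = 0 := by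
  rw [coprimeGenerators, Finset.mem_filter]
  have key : ∀ u v : Fin n →₀ ℕ, u ⊓ v = 0 ↔ ∀ x, u x ≠ 0 → v x = 0 := by
    intro u v
    rw [DFunLike.ext_iff]
    refine forall_congr' fun x => ?_
    rw [Finsupp.inf_apply, Finsupp.zero_apply]
    omega
  constructor
  · rintro ⟨-, h⟩ m' hm'
    exact (key _ _).1 (h m' m'.2 fun e => hm' (Subtype.ext e))
  · exact fun h => ⟨m.2, fun m' hm' hne =>
      (key _ _).2 (h ⟨m', hm'⟩ fun e => hne (congrArg Subtype.val e))⟩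

/-- Each variable `z m` is shared, or `m` is coprime to the other generators. -/
theorem card_image_eq (H : IsDominantFactorization G y z) :
    (Finset.univ.image z).card = (coprimeGenerators G).card + (sharedVariables G).card := by
  classical
  have hU : (coprimeGenerators G).card =
      ((Finset.univ.filter fun m : G => (m : Fin n →₀ ℕ) ∈ coprimeGenerators G).image z).card := by
    rw [Finset.card_image_of_injOn]
    · refine (Finset.card_bij (fun (m : G) _ => (m : Fin n →₀ ℕ)) ?_ ?_ ?_).symm
      · exact fun m hm => (Finset.mem_filter.1 hm).2
      · exact fun m _ m' _ h => Subtype.ext h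
      · exact fun m hm => ⟨⟨m, (Finset.mem_filter.1 hm).1⟩,
          Finset.mem_filter.2 ⟨Finset.mem_univ _, hm⟩, rfl⟩
    · intro m hm m' _ h
      by_contra hne
      have h1 := (mem_coprimeGenerators_iff m).1 (Finset.mem_filter.1 hm).2 m' (Ne.symm hne) (z m)
        ((H.apply_ne_zero_iff _ _).2 (Or.inr rfl))
      exact (H.apply_ne_zero_iff _ _).2 (Or.inr h.symm) h1
  rw [hU, ← Finset.card_union_of_disjoint]
  · congr 1
    ext x
    rw [Finset.mem_union, Finset.mem_image, Finset.mem_image, mem_sharedVariables_iff]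
    constructor
    · rintro ⟨m, -, rfl⟩
      by_cases hm : (m : Fin n →₀ ℕ) ∈ coprimeGenerators G
      · exact Or.inl ⟨m, Finset.mem_filter.2 ⟨Finset.mem_univ _, hm⟩, rfl⟩
      · right
        rw [mem_coprimeGenerators_iff] at hm
        push Not at hm
        obtain ⟨m', hne, x, hx, hx'⟩ := hm
        -- A variable shared by `m` is `z m`, or is `y m`, in which case `m` is a square and again
        -- `z m = x`.
        have hxz : z m = x := by
          rcases (H.apply_ne_zero_iff _ _).1 hx with h | h
          · subst h
            exact H.eq_of_apply_ne_zero hne hx'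
          · exact h
        subst hxz
        exact ⟨m, m', Ne.symm hne, hx, hx'⟩
    · rintro (⟨m, -, rfl⟩ | ⟨m, m', hne, hx, hx'⟩)
      · exact ⟨m, Finset.mem_univ _, rfl⟩
      · rcases (H.apply_ne_zero_iff _ _).1 hx with h | h
        · subst h
          exact ⟨m, Finset.mem_univ _, H.eq_of_apply_ne_zero (Ne.symm hne) hx'⟩
        · exact ⟨m, Finset.mem_univ _, h⟩
  · rw [Finset.disjoint_left]
    intro x hx hs
    obtain ⟨m, hm, rfl⟩ := Finset.mem_image.1 hx
    have hm' := (mem_coprimeGenerators_iff m).1 (Finset.mem_filter.1 hm).2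
    have hz : (m : Fin n →₀ ℕ) (z m) ≠ 0 := (H.apply_ne_zero_iff _ _).2 (Or.inr rfl)
    obtain ⟨m₁, m₂, hne, h1, h2⟩ := mem_sharedVariables_iff.1 hs
    by_cases h : m₁ = m
    · exact h2 (hm' m₂ (fun e => hne (h.trans e.symm)) _ hz)
    · exact h1 (hm' m₁ h _ hz)

variable {K : Type*} [Field K]

theorem monomial_eq (H : IsDominantFactorization G y z) (m : G) :
    (monomial (m : Fin n →₀ ℕ) 1 : MvPolynomial (Fin n) K) = X (y m) * X (z m) := by
  rw [H.eq_add m, X, X, monomial_mul, one_mul]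

theorem monomialIdeal_le (H : IsDominantFactorization G y z) :
    monomialIdeal K G ≤
      Ideal.span (X '' ((Finset.univ.image z : Finset (Fin n)) : Set (Fin n))) := by
  rw [monomialIdeal, Ideal.span_le]
  rintro _ ⟨m, hm, rfl⟩
  have h := H.monomial_eq (K := K) ⟨m, hm⟩
  simp only at h
  simp only [SetLike.mem_coe, h]
  exact Ideal.mul_mem_left _ _ (Ideal.subset_span ⟨_, by simp, rfl⟩)

/-- A prime ideal containing all generators contains as many variables as there are `z m`. -/
theorem card_le_height_of_isPrime (H : IsDominantFactorization G y z)
    (P : Ideal (MvPolynomial (Fin n) K)) [hP : P.IsPrime] (hle : monomialIdeal K G ≤ P) :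
    ((Finset.univ.image z).card : ℕ∞) ≤ P.height := by
  -- For each value `x = z m` one generator `m` is chosen, and `w x` is whichever of its two
  -- variables is found in `P`.
  have key : ∀ x : Fin n, ∃ w : Fin n, x ∈ Finset.univ.image z →
      (X w : MvPolynomial (Fin n) K) ∈ P ∧ (w = x ∨ ∃ m, z m = x ∧ w = y m) := by
    intro x
    by_cases hx : x ∈ Finset.univ.image z
    · obtain ⟨m, -, rfl⟩ := Finset.mem_image.1 hx
      have h1 : (X (y m) * X (z m) : MvPolynomial (Fin n) K) ∈ P := by
        rw [← H.monomial_eq]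
        exact hle (Ideal.subset_span ⟨m, m.2, rfl⟩)
      rcases hP.mem_or_mem h1 with h | h
      · exact ⟨y m, fun _ => ⟨h, Or.inr ⟨m, rfl, rfl⟩⟩⟩
      · exact ⟨z m, fun _ => ⟨h, Or.inl rfl⟩⟩
    · exact ⟨x, fun h => absurd h hx⟩
  choose w hw using key
  -- A collision between some `y m` and a value of `z` is harmless: it forces `z m` to be that same
  -- value.
  have aux : ∀ m : G, ∀ x ∈ Finset.univ.image z, x = y m → z m = y m := by
    intro m x hx h
    obtain ⟨m', -, hm'⟩ := Finset.mem_image.1 hx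
    by_cases hne : m' = m
    · rw [← hne, hm', hne, h]
    · exact H.eq_of_apply_ne_zero hne ((H.apply_ne_zero_iff _ _).2 (Or.inr (hm'.trans h)))
  have hinj : Set.InjOn w (Finset.univ.image z : Finset (Fin n)) := by
    intro x hx x' hx' h
    rcases (hw x hx).2 with h1 | ⟨m, hm, h1⟩ <;> rcases (hw x' hx').2 with h2 | ⟨m', hm', h2⟩
    · rw [← h1, h, h2]
    · have e : x = y m' := by rw [← h1, h, h2]
      rw [e, ← aux m' x hx e, hm']
    · have e : x' = y m := by rw [← h2, ← h, h1]
      rw [e, ← aux m x' hx' e, hm]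
    · have e : m = m' := H.injective (by rw [← h1, h, h2])
      rw [← hm, ← hm', e]
  rw [← Finset.card_image_of_injOn hinj]
  refine (card_le_height_span_X _).trans (Ideal.height_mono ?_)
  rw [Ideal.span_le]
  rintro _ ⟨i, hi, rfl⟩
  obtain ⟨x, hx, rfl⟩ := Finset.mem_image.1 (Finset.mem_coe.1 hi)
  exact (hw x hx).1

theorem height_monomialIdeal (H : IsDominantFactorization G y z) :
    (monomialIdeal K G).height = (Finset.univ.image z).card := by
  apply le_antisymm
  · exact (Ideal.height_mono H.monomialIdeal_le).trans (height_span_X _).le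
  · rw [Ideal.height_eq_inf_minimalPrimes]
    refine le_iInf₂ fun P hP => ?_
    have := hP.isPrime
    exact H.card_le_height_of_isPrime P hP.le

end IsDominantFactorization

end QuadraticDominant

/-! ### Regularity and codimension. -/

theorem mainTheorem7 {K : Type*} [Field K] {n : ℕ} (M : Ideal (MvPolynomial (Fin n) K))
    (G : Finset (Fin n →₀ ℕ)) (hG : IsMinimallyGeneratedBy M G)
    (hquadratic : ∀ m ∈ G, m.degree = 2) (hdominant : ∀ m ∈ G, IsDominantIn G m) :
    HasRegularity K n (quotientPart M)
        (((coprimeGenerators G).card + (sharedVariables G).card : ℕ) : ℤ) ∧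
      moduleCodim (MvPolynomial (Fin n) K) (MvPolynomial (Fin n) K ⧸ M) =
        (((coprimeGenerators G).card + (sharedVariables G).card : ℕ) : ℕ∞) := by
  obtain ⟨y, z, H⟩ := exists_isDominantFactorization hquadratic hdominant
  have hm := H.sup_erase_ne G.equivFin.symm.injective
  have hM : M = Ideal.span (Set.range fun g =>
      (monomial (G.equivFin.symm g : Fin n →₀ ℕ) 1 : MvPolynomial (Fin n) K)) := by
    rw [← hG.1, monomialIdeal]
    congr 1
    ext p
    constructor
    · rintro ⟨m, hm, rfl⟩
      exact ⟨G.equivFin ⟨m, hm⟩, by simp⟩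
    · rintro ⟨g, rfl⟩
      exact ⟨_, (G.equivFin.symm g).2, rfl⟩
  have hsup : (Finset.univ.sup fun g => (G.equivFin.symm g : Fin n →₀ ℕ)).degree =
      G.card + (Finset.univ.image z).card := by
    rw [← H.degree_sup_eq, ← Finset.univ_map_equiv_to_embedding G.equivFin.symm, Finset.sup_map]
    rfl
  rw [← H.card_image_eq]
  -- The maximum is attained in homological degree `G.card`, by the lcm of all generators.
  refine ⟨⟨⟨Taylor.resolution _ M hM hm⟩, fun F => ⟨⟨G.card, ?_⟩, ?_⟩⟩, ?_⟩
  · rw [Taylor.betti_ne_zero_iff _ M hM hm]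
    exact ⟨Finset.univ, by simp, by rw [hsup]; push_cast; rfl⟩
  · rintro s ⟨i, hi⟩
    obtain ⟨σ, hσ, hdeg⟩ := (Taylor.betti_ne_zero_iff _ M hM hm F _ _).1 hi
    have h1 := degree_sup_add_card_le hm (Finset.subset_univ σ)
    rw [hsup, Finset.card_univ, Fintype.card_fin] at h1
    omega
  · rw [moduleCodim, Ideal.annihilator_quotient, ← hG.1, H.height_monomialIdeal]
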